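/- All graphs are finite and simple. A $c$-colouring of a graph $G$ is a function assigning to each vertex one of $c$ colours (adjacent vertices may receive the same colour); its clustering is the maximum number of vertices in a monochromatic component, that is, in a connected component of the subgraph of $G$ induced by the vertices of a single colour. The strong product $G\boxtimes H$ has vertex set $V(G)\times V(H)$, where $(u,v)$ and $(u',v')$ are adjacent if $u=u'$ and $vv'\in E(H)$, or $v=v'$ and $uu'\in E(G)$, or $uu'\in E(G)$ and $vv'\in E(H)$. For any positive integers $t,c,\Delta$, for any graph $H_1$ with treewidth at most $t$, and any graph $H_2$ with treewidth at most $t$ and maximum degree at most $\Delta$, the graph $G:=H_1\boxtimes H_2$ is $c$-colourable with clustering at most $$6^{c+1}\,(t+1)^2\,\Delta^c\,|V(G)|^{c/(c^2-c+1)}.$$ -/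

import Mathlib

namespace SimpleGraph

/-- The strong product of two graphs. -/
def strongProduct {V W : Type*} (G : SimpleGraph V) (H : SimpleGraph W) :
    SimpleGraph (V × W) where
  Adj p q :=
    (p.1 = q.1 ∧ H.Adj p.2 q.2) ∨ (p.2 = q.2 ∧ G.Adj p.1 q.1) ∨
      (G.Adj p.1 q.1 ∧ H.Adj p.2 q.2)
  symm := ⟨by
    rintro p q (⟨h, h'⟩ | ⟨h, h'⟩ | ⟨h, h'⟩)
    · exact Or.inl ⟨h.symm, h'.symm⟩
    · exact Or.inr (Or.inl ⟨h.symm, h'.symm⟩)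
    · exact Or.inr (Or.inr ⟨h.symm, h'.symm⟩)⟩
  loopless := ⟨by
    rintro p (⟨-, h⟩ | ⟨-, h⟩ | ⟨h, -⟩)
    · exact H.loopless.irrefl _ h
    · exact G.loopless.irrefl _ h
    · exact G.loopless.irrefl _ h⟩

/-- A `T`-decomposition of `G`, where `T` is a tree. Connectedness of an induced subgraph
includes that it is nonempty, so every vertex of `G` lies in some bag. -/
structure TreeDecomposition {V ι : Type*} (G : SimpleGraph V) (T : SimpleGraph ι) where
  isTree : T.IsTree
  bag : ι → Finset V
  exists_bag_of_adj : ∀ ⦃v w : V⦄, G.Adj v w → ∃ x, v ∈ bag x ∧ w ∈ bag x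
  connected_of_vertex : ∀ v : V, (T.induce {x | v ∈ bag x}).Connected

/-- The width of a tree-decomposition: the maximum size of a bag, minus one. -/
def TreeDecomposition.width {V ι : Type*} [Fintype ι] {G : SimpleGraph V} {T : SimpleGraph ι}
    (D : G.TreeDecomposition T) : ℤ :=
  ((Finset.univ.sup fun x => (D.bag x).card : ℕ) : ℤ) - 1

/-- The widths of all tree-decompositions of `G` over finite trees. -/
def treeDecompositionWidths {V : Type*} (G : SimpleGraph V) : Set ℤ :=
  {k | ∃ (m : ℕ) (T : SimpleGraph (Fin m)) (D : G.TreeDecomposition T), D.width = k}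

/-- The treewidth of a finite graph: the minimum width of a tree-decomposition
(it is `-1` for the graph without vertices). -/
noncomputable def treewidth {V : Type*} (G : SimpleGraph V) : ℤ :=
  sInf G.treeDecompositionWidths

/-- For a finite graph the infimum in the definition of treewidth is a minimum. -/
theorem treewidth_mem {V : Type*} [Finite V] (G : SimpleGraph V) :
    G.treewidth ∈ G.treeDecompositionWidths := by
  have := Fintype.ofFinite V
  refine Int.csInf_mem ?_ ⟨-1, ?_⟩
  · refine ⟨_, 1, ⊥, ⟨?_, fun _ => Finset.univ, ?_, ?_⟩, rfl⟩
    · exact IsTree.of_subsingleton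
    · exact fun v w _ => ⟨0, by simp, by simp⟩
    · intro v
      have : Nonempty {x : Fin 1 | v ∈ (Finset.univ : Finset V)} := ⟨⟨0, by simp⟩⟩
      exact { preconnected := Preconnected.of_subsingleton }
  · rintro k ⟨m, T, D, rfl⟩
    simp only [TreeDecomposition.width]
    omega

/-- `S` is the vertex set of a monochromatic component of the colouring `f` of `G`: a connected
component of the subgraph induced by the vertices of a single colour. -/
def IsMonochromaticComponent {V α : Type*} (G : SimpleGraph V) (f : V → α) (S : Set V) : Prop :=
  ∃ (i : α) (C : (G.induce {v | f v = i}).ConnectedComponent), S = Subtype.val '' C.supp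

/-- The clustering of a colouring of a finite graph: the maximum number of vertices in a
monochromatic component (`0` for the graph without vertices). -/
noncomputable def clustering {V α : Type*} (G : SimpleGraph V) (f : V → α) : ℕ :=
  sSup {k | ∃ S, G.IsMonochromaticComponent f S ∧ S.ncard = k}

/-- `G` is `c`-colourable with clustering at most `k`; adjacent vertices may share a colour. -/
def ColourableWithClusteringAtMost {V : Type*} (G : SimpleGraph V) (c : ℕ) (k : ℝ) : Prop :=
  ∃ f : V → Fin c, (G.clustering f : ℝ) ≤ k

end SimpleGraph

/-!
A colouring of a strong product has small clustering as soon as every connected monochromatic set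
has small projections to both factors, since these projections are connected. Let `K = t + 1` and
let `n₁`, `n₂` be the numbers of vertices of `H₁` and `H₂`.

* A graph of treewidth at most `t` with `n` vertices is `d`-colourable with clustering at most
  `2 * K * n ^ (1 / d)` (`TreeDecomposition.exists_clustered_colouring`): one colour class cuts the
  graph into pieces of size `n ^ ((d - 1) / d)`, which are coloured recursively.
* If moreover the maximum degree is at most `Δ`, the graph has a layering, with edges only within
  layers and between consecutive layers, in which a connected set within a bounded number of
  consecutive layers is bounded in size (`TreeDecomposition.hasLayering`). The construction is that
  of tree-partitions of bounded width, of which only the depths of the parts are kept.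

Both rest on `TreeDecomposition.exists_separation`, which provides small separators that split off
a prescribed proportion of a given set.

If `n₂ ^ (c * (c - 1)) ≤ n₁`, then `(u, v)` is given the colour of `u` in a `c`-colouring of `H₁`,
with clustering of order `n₁ ^ (1 / c) * n₂`. Otherwise `H₁` is divided into only `m = c - 1`
classes, with components of order `n₁ ^ (1 / m)`. In each layer of `H₂` the classes receive distinct
colours, so that one of the `m + 1` colours is spare; in passing to the next layer a single class
moves to the spare colour, in cyclic order. Then neither two classes nor two rounds of the cyclic
order are joined by an edge within a colour (`eq_and_div_eq_of_modEq`), so a monochromatic component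
projects into a component of a class of `H₁` and into `m` consecutive layers of `H₂`. In either case
the exponents compare with `c / (c ^ 2 - c + 1)`, and they balance at `n₁ = n₂ ^ (c * (c - 1))`.
-/

namespace SimpleGraph

open Finset

section

variable {V : Type*} {G : SimpleGraph V}

/-! ### Connected sets of vertices -/

/-- The finite set `L` of vertices induces a preconnected subgraph of `G`. -/
def PreconnectedOn (G : SimpleGraph V) (L : Finset V) : Prop :=
  (G.induce (L : Set V)).Preconnected

theorem PreconnectedOn.induction {L : Finset V} (hL : G.PreconnectedOn L) (P : V → Prop)
    (hP : ∀ u ∈ L, ∀ v ∈ L, G.Adj u v → P u → P v) {u v : V} (hu : u ∈ L) (hv : v ∈ L)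
    (h : P u) : P v := by
  obtain ⟨w⟩ := hL ⟨u, hu⟩ ⟨v, hv⟩
  have key : ∀ {a b : (L : Set V)}, (G.induce (L : Set V)).Walk a b → P a → P b := by
    intro a b w
    induction w with
    | nil => exact id
    | cons hadj _ ih => exact fun h => ih (hP _ (Subtype.prop _) _ (Subtype.prop _) hadj h)
  exact key w h

theorem preconnectedOn_of_induction {L : Finset V}
    (h : ∀ P : V → Prop, (∀ u ∈ L, ∀ v ∈ L, G.Adj u v → P u → P v) →
      ∀ u ∈ L, ∀ v ∈ L, P u → P v) : G.PreconnectedOn L := by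
  rintro ⟨u, hu⟩ ⟨v, hv⟩
  refine (h (fun w => ∃ hw : w ∈ (L : Set V),
    (G.induce (L : Set V)).Reachable ⟨u, hu⟩ ⟨w, hw⟩) ?_ u hu v hv ⟨hu, .refl _⟩).2
  rintro a - b hb hab ⟨_, hr⟩
  exact ⟨hb, hr.trans (Adj.reachable (by exact hab))⟩

theorem preconnectedOn_of_connectedComponent {X : Set V} (C : (G.induce X).ConnectedComponent)
    {L : Finset V}
    (hL : ∀ v, v ∈ L ↔ ∃ h : v ∈ X, (G.induce X).connectedComponentMk ⟨v, h⟩ = C) :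
    G.PreconnectedOn L := by
  refine preconnectedOn_of_induction fun P hP u hu v hv hPu => ?_
  have key : ∀ {a b : X}, (G.induce X).Walk a b → (G.induce X).connectedComponentMk a = C →
      P a → P b := by
    intro a b w
    induction w with
    | nil => exact fun _ => id
    | @cons a c _ hadj _ ih =>
      intro ha hPa
      have hc : (G.induce X).connectedComponentMk c = C :=
        (ConnectedComponent.sound hadj.reachable).symm.trans ha
      exact ih hc (hP _ ((hL _).2 ⟨a.2, ha⟩) _ ((hL _).2 ⟨c.2, hc⟩) hadj hPa)
  obtain ⟨hu', huC⟩ := (hL u).1 hu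
  obtain ⟨hv', hvC⟩ := (hL v).1 hv
  obtain ⟨w⟩ := ConnectedComponent.exact (huC.trans hvC.symm)
  exact key w huC hPu

/-- A function that is constant along the edges of a preconnected set is constant on it. -/
theorem PreconnectedOn.eq_of_adj {α : Type*} {L : Finset V} (hL : G.PreconnectedOn L) (f : V → α)
    (hf : ∀ u ∈ L, ∀ v ∈ L, G.Adj u v → f u = f v) {u v : V} (hu : u ∈ L) (hv : v ∈ L) :
    f u = f v :=
  hL.induction (fun w => f u = f w) (fun _ ha _ hb hab h => h.trans (hf _ ha _ hb hab)) hu hv rfl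

/-! ### Separations from tree-decompositions -/

/-- `(A, B)` is a separation of the subgraph of `G` induced by `U`: the two sides cover `U`, and
no edge joins a vertex of `A` outside `B` to a vertex of `B` outside `A`. -/
structure IsSeparation [DecidableEq V] (G : SimpleGraph V) (U A B : Finset V) : Prop where
  union_eq : A ∪ B = U
  not_adj : ∀ u ∈ A \ B, ∀ v ∈ B \ A, ¬ G.Adj u v

theorem IsSeparation.subset_or_subset [DecidableEq V] {U A B L : Finset V}
    (h : G.IsSeparation U A B) (hL : G.PreconnectedOn L) (hLU : L ⊆ U)
    (hd : ∀ v ∈ L, v ∈ A → v ∉ B) :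
    L ⊆ A \ B ∨ L ⊆ B \ A := by
  have hcov : ∀ v ∈ L, v ∈ A \ B ∨ v ∈ B \ A := by
    intro v hv
    have h1 := hLU hv
    have h2 := hd v hv
    rw [← h.union_eq] at h1
    simp only [mem_union, mem_sdiff] at *
    tauto
  by_cases hA : ∃ u ∈ L, u ∈ A \ B
  · obtain ⟨u, hu, huA⟩ := hA
    refine Or.inl fun v hv => hL.induction (· ∈ A \ B) ?_ hu hv huA
    intro a ha b hb hab haA
    exact (hcov b hb).resolve_right fun hbB => h.not_adj a haA b hbB hab
  · exact Or.inr fun v hv => (hcov v hv).resolve_left fun h' => hA ⟨v, hv, h'⟩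

/-- In a tree, the set `Z` of nodes on the side of `y` of an edge `xy` is left by that edge only;
it stays within any set `Y ∋ y` that is left by edges at `x` only. -/
theorem IsTree.exists_side {ι : Type*} {T : SimpleGraph ι} (hT : T.IsTree) {x y : ι}
    (hxy : T.Adj x y) (Y : Set ι) (hy : y ∈ Y) (hY : ∀ a ∈ Y, ∀ b ∉ Y, T.Adj a b → a = x) :
    ∃ Z ⊆ Y, y ∈ Z ∧ x ∉ Z ∧ ∀ a ∈ Z, ∀ b ∉ Z, T.Adj a b → a = y ∧ b = x := by
  have hb : ¬ (T.deleteEdges {s(x, y)}).Reachable x y := by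
    exact isBridge_iff.1 (isAcyclic_iff_forall_adj_isBridge.1 hT.isAcyclic hxy)
  refine ⟨{z | (T.deleteEdges {s(x, y)}).Reachable y z}, ?_, .refl _, fun h => hb h.symm, ?_⟩
  · rintro z ⟨w⟩
    have key : ∀ {a b : ι}, (T.deleteEdges {s(x, y)}).Walk a b →
        (T.deleteEdges {s(x, y)}).Reachable y a → a ∈ Y → b ∈ Y := by
      intro a b w
      induction w with
      | nil => exact fun _ h => h
      | @cons a c _ hadj _ ih =>
        intro hr ha
        refine ih (hr.trans hadj.reachable) ?_
        by_contra hc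
        have := hY a ha c hc (deleteEdges_adj.1 hadj).1
        exact hb (this ▸ hr.symm)
    exact key w (.refl _) hy
  · intro a ha b hnb hab
    have hnot : ¬ (T.deleteEdges {s(x, y)}).Adj a b := fun h =>
      hnb (Reachable.trans ha h.reachable)
    rw [deleteEdges_adj] at hnot
    have : s(a, b) = s(x, y) := by
      by_contra hne
      exact hnot ⟨hab, hne⟩
    rcases Sym2.eq_iff.1 this with ⟨rfl, rfl⟩ | ⟨rfl, rfl⟩
    · exact absurd ha (fun h => hb (Reachable.symm h))
    · exact ⟨rfl, rfl⟩

/-- If a set `Y` of nodes of a tree-decomposition is left by edges at `x` only, then the bags at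
`Y` and the bags at the other nodes meet within the bag at `x`. -/
theorem TreeDecomposition.mem_bag_of_mem_of_notMem {ι : Type*} {T : SimpleGraph ι}
    (D : G.TreeDecomposition T) {x : ι} {Y : Set ι}
    (hY : ∀ a ∈ Y, ∀ b ∉ Y, T.Adj a b → a = x) {y z : ι} (hy : y ∈ Y) (hz : z ∉ Y) {v : V}
    (hvy : v ∈ D.bag y) (hvz : v ∈ D.bag z) : v ∈ D.bag x := by
  obtain ⟨w⟩ := (D.connected_of_vertex v).preconnected ⟨y, hvy⟩ ⟨z, hvz⟩
  have key : ∀ {a b : {x | v ∈ D.bag x}}, (T.induce {x | v ∈ D.bag x}).Walk a b →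
      a.1 ∈ Y → b.1 ∉ Y → v ∈ D.bag x := by
    intro a b w
    induction w with
    | nil => exact fun h h' => absurd h h'
    | @cons a c _ hadj _ ih =>
      intro ha hb
      by_cases hc : c.1 ∈ Y
      · exact ih hc hb
      · exact hY _ ha _ hc hadj ▸ a.2
  exact key w hy hz

/-- A graph with a tree-decomposition into bags of size at most `K` has a separation of order at
most `K` one side of which contains more than `q` and at most `2 * q` vertices of a given set.

Consider sets `Y` of nodes that are left by edges at a single node `x` only, and let `Y` be minimal
such that its bags contain more than `q` vertices of `W`. An edge from `x` into `Y` splits `Y` into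
two sets of the same kind, each of which meets `W` in at most `q` vertices by minimality. -/
theorem TreeDecomposition.exists_separation [DecidableEq V] {ι : Type*} [Fintype ι]
    {T : SimpleGraph ι} (D : G.TreeDecomposition T) {K : ℕ} (hK : ∀ x, #(D.bag x) ≤ K) {q : ℝ}
    (hq : (K : ℝ) ≤ q) {U W : Finset V} (hWU : W ⊆ U) (hW : q < #W) :
    ∃ A B, G.IsSeparation U A B ∧ #(A ∩ B) ≤ K ∧ q < #(W ∩ A) ∧ (#(W ∩ A) : ℝ) ≤ 2 * q := by
  classical
  have hbag : ∀ v, ∃ x, v ∈ D.bag x := fun v =>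
    let ⟨x⟩ := (D.connected_of_vertex v).nonempty; ⟨x.1, x.2⟩
  let good : ι → Finset ι → Prop := fun x Y =>
    x ∈ Y ∧ (∀ a ∈ Y, ∀ b ∉ Y, T.Adj a b → a = x) ∧ q < #(W.filter fun v => ∃ y ∈ Y, v ∈ D.bag y)
  have hex : ∃ n, ∃ x Y, good x Y ∧ #Y = n := by
    obtain ⟨x⟩ := D.isTree.connected.nonempty
    refine ⟨_, x, univ, ⟨mem_univ _, fun a _ b hb => absurd (mem_univ b) hb, ?_⟩, rfl⟩
    simpa [hbag] using hW
  obtain ⟨x, Y, ⟨hxY, hY, hqY⟩, hn⟩ := Nat.find_spec hex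
  have hmin : ∀ x' Y', #Y' < #Y → x' ∈ Y' → (∀ a ∈ Y', ∀ b ∉ Y', T.Adj a b → a = x') →
      (#(W.filter fun v => ∃ y ∈ Y', v ∈ D.bag y) : ℝ) ≤ q := by
    intro x' Y' hlt hx' hY'
    by_contra hcon
    exact Nat.find_min hex (hn ▸ hlt) ⟨x', Y', ⟨hx', hY', not_le.1 hcon⟩, rfl⟩
  have hle : (#(W.filter fun v => ∃ y ∈ Y, v ∈ D.bag y) : ℝ) ≤ 2 * q := by
    -- otherwise `Y = {x}`, but the bag at `x` has at most `K ≤ q` vertices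
    have hnbr : ∃ y ∈ Y, T.Adj x y := by
      by_contra! hno
      -- a walk that starts in `Y` away from `x` would have to leave `Y` before it reaches `x`
      have key : ∀ {a b : ι}, T.Walk a b → a ∈ Y → a ≠ x → b ≠ x := by
        intro a b w
        induction w with
        | nil => exact fun _ h => h
        | @cons a c _ hadj _ ih =>
          intro ha hax
          have hc : c ∈ Y := by
            by_contra hc
            exact hax (hY a ha c hc hadj)
          exact ih hc fun hcx => hno a ha (hcx ▸ hadj.symm)
      have hsub : Y ⊆ {x} := by
        intro y hy
        obtain ⟨w⟩ := D.isTree.connected.preconnected y x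
        by_contra hne
        exact key w hy (fun h => hne (mem_singleton.2 h)) rfl
      have h1 : #(W.filter fun v => ∃ y ∈ Y, v ∈ D.bag y) ≤ K := by
        refine (card_le_card fun v hv => ?_).trans (hK x)
        obtain ⟨y, hy, hv⟩ := (mem_filter.1 hv).2
        exact mem_singleton.1 (hsub hy) ▸ hv
      exact absurd (hqY.trans_le ((Nat.cast_le.2 h1).trans hq)) (lt_irrefl _)
    obtain ⟨y, hyY, hxy⟩ := hnbr
    obtain ⟨Z, hZY, hyZ, hxZ, hZ⟩ := D.isTree.exists_side hxy (Y : Set ι) hyY hY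
    have h1 := hmin y (Y.filter (· ∈ Z)) (card_lt_card (filter_ssubset.2 ⟨x, hxY, hxZ⟩))
      (mem_filter.2 ⟨hyY, hyZ⟩) (by
        intro a ha b hb hab
        have hb' : b ∉ Z := fun h => hb (mem_filter.2 ⟨hZY h, h⟩)
        exact (hZ a (mem_filter.1 ha).2 b hb' hab).1)
    have h2 := hmin x (Y.filter (· ∉ Z))
      (card_lt_card (filter_ssubset.2 ⟨y, hyY, not_not.2 hyZ⟩))
      (mem_filter.2 ⟨hxY, hxZ⟩) (by
        intro a ha b hb hab
        by_cases hbY : b ∈ Y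
        · have hbZ : b ∈ Z := by
            by_contra h
            exact hb (mem_filter.2 ⟨hbY, h⟩)
          exact (hZ b hbZ a (mem_filter.1 ha).2 hab.symm).2
        · exact hY a (mem_filter.1 ha).1 b hbY hab)
    have h3 : #(W.filter fun v => ∃ y ∈ Y, v ∈ D.bag y) ≤
        #(W.filter fun v => ∃ y ∈ Y.filter (· ∈ Z), v ∈ D.bag y) +
        #(W.filter fun v => ∃ y ∈ Y.filter (· ∉ Z), v ∈ D.bag y) := by
      refine (card_le_card fun v hv => ?_).trans (card_union_le _ _)
      obtain ⟨hvW, z, hz, hv⟩ := mem_filter.1 hv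
      by_cases hzZ : z ∈ Z
      · exact mem_union_left _ (mem_filter.2 ⟨hvW, z, mem_filter.2 ⟨hz, hzZ⟩, hv⟩)
      · exact mem_union_right _ (mem_filter.2 ⟨hvW, z, mem_filter.2 ⟨hz, hzZ⟩, hv⟩)
    have h4 := (Nat.cast_le (α := ℝ)).2 h3
    push_cast at h4
    linarith
  have hWA : W ∩ U.filter (fun v => ∃ y ∈ Y, v ∈ D.bag y) =
      W.filter fun v => ∃ y ∈ Y, v ∈ D.bag y := by
    ext v
    simp only [mem_inter, mem_filter]
    exact ⟨fun h => ⟨h.1, h.2.2⟩, fun h => ⟨h.1, hWU h.1, h.2⟩⟩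
  refine ⟨U.filter fun v => ∃ y ∈ Y, v ∈ D.bag y,
    U.filter fun v => ∃ y, (y ∉ Y ∨ y = x) ∧ v ∈ D.bag y, ⟨?_, ?_⟩, ?_, ?_, ?_⟩
  · ext v
    simp only [mem_union, mem_filter]
    refine ⟨fun h => h.elim And.left And.left, fun h => ?_⟩
    obtain ⟨y, hy⟩ := hbag v
    by_cases hyY : y ∈ Y
    · exact Or.inl ⟨h, y, hyY, hy⟩
    · exact Or.inr ⟨h, y, Or.inl hyY, hy⟩
  · intro u hu v hv huv
    simp only [mem_sdiff, mem_filter] at hu hv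
    obtain ⟨z, huz, hvz⟩ := D.exists_bag_of_adj huv
    by_cases hz : z ∈ Y
    · exact hv.2 ⟨hv.1.1, z, hz, hvz⟩
    · exact hu.2 ⟨hu.1.1, z, Or.inl hz, huz⟩
  · refine (card_le_card fun v hv => ?_).trans (hK x)
    simp only [mem_inter, mem_filter] at hv
    obtain ⟨⟨-, y, hy, hvy⟩, -, z, hz | rfl, hvz⟩ := hv
    · exact D.mem_bag_of_mem_of_notMem (Y := (Y : Set ι)) hY hy hz hvy hvz
    · exact hvz
  · rwa [hWA]
  · rwa [hWA]

/-! ### Clustered colourings of graphs of bounded treewidth -/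

/-- Deleting few vertices leaves small components: the separations of `exists_separation` are
split off one after the other. -/
theorem TreeDecomposition.exists_cut [DecidableEq V] {ι : Type*} [Fintype ι] {T : SimpleGraph ι}
    (D : G.TreeDecomposition T) {K : ℕ} (hK : ∀ x, #(D.bag x) ≤ K) {q : ℝ} (hq : (K : ℝ) ≤ q)
    (U : Finset V) :
    ∃ S ⊆ U, (#S : ℝ) * q ≤ K * #U ∧
      ∀ L ⊆ U \ S, G.PreconnectedOn L → (#L : ℝ) ≤ 2 * q := by
  have hq0 : 0 ≤ q := K.cast_nonneg.trans hq
  induction U using Finset.strongInduction with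
  | H U ih =>
  by_cases hU : (#U : ℝ) ≤ q
  · refine ⟨∅, empty_subset _, by simp; positivity, fun L hL _ => ?_⟩
    have : (#L : ℝ) ≤ #U := Nat.cast_le.2 (card_le_card (hL.trans sdiff_subset))
    linarith
  obtain ⟨A, B, hAB, hX, hA, hA'⟩ := D.exists_separation hK hq subset_rfl (not_le.1 hU)
  have hAU : A ⊆ U := hAB.union_eq ▸ subset_union_left
  rw [inter_eq_right.2 hAU] at hA hA'
  have hlt : U \ A ⊂ U := by
    refine sdiff_ssubset hAU (card_pos.1 ?_)
    exact_mod_cast hq0.trans_lt hA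
  obtain ⟨S, hS, hSq, hSL⟩ := ih (U \ A) hlt
  refine ⟨S ∪ A ∩ B, union_subset (hS.trans sdiff_subset) (inter_subset_left.trans hAU), ?_, ?_⟩
  · have h1 : (#(S ∪ A ∩ B) : ℝ) ≤ #S + K :=
      mod_cast (card_union_le _ _).trans (Nat.add_le_add_left hX _)
    have h2 : (#(U \ A) : ℝ) + #A = #U := mod_cast card_sdiff_add_card_eq_card hAU
    have h3 : (0 : ℝ) ≤ K := K.cast_nonneg
    nlinarith
  · intro L hL hLc
    rcases hAB.subset_or_subset hLc (hL.trans sdiff_subset) (fun v hv hvA hvB =>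
      (mem_sdiff.1 (hL hv)).2 (mem_union_right _ (mem_inter.2 ⟨hvA, hvB⟩))) with h | h
    · exact (Nat.cast_le.2 (card_le_card (h.trans sdiff_subset))).trans hA'
    · refine hSL L (fun v hv => ?_) hLc
      have h1 := mem_sdiff.1 (hL hv)
      exact mem_sdiff.2 ⟨mem_sdiff.2 ⟨h1.1, (mem_sdiff.1 (h hv)).2⟩,
        fun h2 => h1.2 (mem_union_left _ h2)⟩

/-- The form of `exists_cut` where only the components of `U`, rather than `U` itself, are bounded
in size; the cuts of the components are put together. -/
theorem TreeDecomposition.exists_cut_of_components [DecidableEq V] {ι : Type*} [Fintype ι]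
    {T : SimpleGraph ι} (D : G.TreeDecomposition T) {K : ℕ} (hK : ∀ x, #(D.bag x) ≤ K) {q M : ℝ}
    (hq : (K : ℝ) ≤ q) (U : Finset V) (hU : ∀ L ⊆ U, G.PreconnectedOn L → (#L : ℝ) ≤ M) :
    ∃ S ⊆ U, (∀ L ⊆ S, G.PreconnectedOn L → (#L : ℝ) * q ≤ K * M) ∧
      ∀ L ⊆ U \ S, G.PreconnectedOn L → (#L : ℝ) ≤ 2 * q := by
  classical
  have hq0 : 0 ≤ q := K.cast_nonneg.trans hq
  have hM : 0 ≤ M := by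
    simpa using hU ∅ (empty_subset _) (preconnectedOn_of_induction (by simp))
  let H := G.induce (U : Set V)
  let comp (C : H.ConnectedComponent) : Finset V :=
    U.filter fun v => ∃ h : v ∈ (U : Set V), H.connectedComponentMk ⟨v, h⟩ = C
  have hcomp : ∀ C, (#(comp C) : ℝ) ≤ M := by
    intro C
    exact hU _ (filter_subset _ _) (preconnectedOn_of_connectedComponent C
      fun v => mem_filter.trans ⟨And.right, fun h => ⟨h.1, h⟩⟩)
  have hsame : ∀ L ⊆ U, G.PreconnectedOn L → L.Nonempty → ∃ C, L ⊆ comp C := by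
    rintro L hL hLc ⟨u, hu⟩
    refine ⟨H.connectedComponentMk ⟨u, hL hu⟩, fun v hv => mem_filter.2 ⟨hL hv, ?_⟩⟩
    refine hLc.induction (fun w => ∃ h : w ∈ (U : Set V), H.connectedComponentMk ⟨w, h⟩ = _) ?_
      hu hv ⟨hL hu, rfl⟩
    rintro a - b hb hab ⟨ha, hC⟩
    refine ⟨hL hb, Eq.trans ?_ hC⟩
    exact (ConnectedComponent.sound (Adj.reachable (by exact hab))).symm
  choose S hS hSq hSL using fun C => D.exists_cut hK hq (comp C)
  have hdisj : ∀ {C C' v}, v ∈ comp C → v ∈ comp C' → C = C' := by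
    intro C C' v h h'
    obtain ⟨-, -, rfl⟩ := mem_filter.1 h
    obtain ⟨-, -, rfl⟩ := mem_filter.1 h'
    rfl
  refine ⟨U.filter fun v => ∃ C, v ∈ S C, filter_subset _ _, ?_, ?_⟩
  · intro L hL hLc
    rcases L.eq_empty_or_nonempty with rfl | hne
    · simp only [card_empty, Nat.cast_zero, zero_mul]
      positivity
    obtain ⟨C, hC⟩ := hsame L (hL.trans (filter_subset _ _)) hLc hne
    have hLS : L ⊆ S C := by
      intro v hv
      obtain ⟨-, C', hv'⟩ := mem_filter.1 (hL hv)
      exact hdisj (hC hv) (hS C' hv') ▸ hv'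
    calc (#L : ℝ) * q ≤ #(S C) * q := by gcongr
      _ ≤ K * #(comp C) := hSq C
      _ ≤ K * M := by gcongr; exact hcomp C
  · intro L hL hLc
    rcases L.eq_empty_or_nonempty with rfl | hne
    · simp only [card_empty, Nat.cast_zero]
      positivity
    obtain ⟨C, hC⟩ := hsame L (hL.trans sdiff_subset) hLc hne
    refine hSL C L (fun v hv => mem_sdiff.2 ⟨hC hv, fun hvS => ?_⟩) hLc
    have := mem_sdiff.1 (hL hv)
    exact this.2 (mem_filter.2 ⟨this.1, C, hvS⟩)

/-- A graph with a tree-decomposition into bags of size at most `K` and with at most `r ^ (d + 1)`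
vertices is `(d + 1)`-colourable with clustering at most `2 * K * r`.

The last colour is given to a set whose components are small and which cuts the graph into pieces
of size at most `r ^ d`. -/
theorem TreeDecomposition.exists_clustered_colouring [DecidableEq V] {ι : Type*} [Fintype ι]
    {T : SimpleGraph ι} (D : G.TreeDecomposition T) {K : ℕ} (hK : ∀ x, #(D.bag x) ≤ K)
    (hK0 : 0 < K) {r : ℝ} (hr : 0 < r) (d : ℕ) (U : Finset V)
    (hU : ∀ L ⊆ U, G.PreconnectedOn L → (#L : ℝ) ≤ r ^ (d + 1)) :
    ∃ f : V → Fin (d + 1), ∀ i, ∀ L ⊆ U, G.PreconnectedOn L → (∀ v ∈ L, f v = i) →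
      (#L : ℝ) ≤ 2 * K * r := by
  have hK1 : (1 : ℝ) ≤ K := mod_cast hK0
  induction d generalizing U with
  | zero =>
    refine ⟨fun _ => 0, fun i L hL hLc _ => ?_⟩
    have := hU L hL hLc
    simp only [zero_add, pow_one] at this
    nlinarith
  | succ d ih =>
    by_cases hq : (K : ℝ) ≤ r ^ (d + 1) / 2
    · obtain ⟨S, hSU, hS, hS'⟩ := D.exists_cut_of_components hK hq U hU
      obtain ⟨f, hf⟩ := ih (U \ S) (by simpa [mul_div_cancel₀] using hS')
      refine ⟨fun v => if v ∈ S then Fin.last _ else (f v).castSucc, fun i L hL hLc hi => ?_⟩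
      induction i using Fin.lastCases with
      | last =>
        beta_reduce at hi
        have hLS : L ⊆ S := by
          intro v hv
          by_contra hvS
          have := hi v hv
          rw [if_neg hvS] at this
          exact (Fin.castSucc_lt_last _).ne this
        have h1 := hS L hLS hLc
        have h2 : 0 < r ^ (d + 1) := by positivity
        have h3 : (#L : ℝ) * r ^ (d + 1) ≤ 2 * K * r * r ^ (d + 1) := by
          rw [pow_succ r (d + 1)] at h1
          linarith
        exact le_of_mul_le_mul_right h3 h2
      | cast i =>
        beta_reduce at hi
        have hLS : ∀ v ∈ L, v ∉ S := by
          intro v hv hvS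
          have := hi v hv
          rw [if_pos hvS] at this
          exact (Fin.castSucc_lt_last _).ne this.symm
        refine hf i L (fun v hv => mem_sdiff.2 ⟨hL hv, hLS v hv⟩) hLc fun v hv => ?_
        have := hi v hv
        rw [if_neg (hLS v hv)] at this
        exact Fin.castSucc_injective _ this
    · -- all components are already smaller than the bound
      refine ⟨fun _ => 0, fun i L hL hLc _ => (hU L hL hLc).trans ?_⟩
      rw [pow_succ]
      have : r ^ (d + 1) ≤ 2 * K := by linarith
      gcongr

/-! ### Layerings of graphs of bounded treewidth and bounded degree -/

/-- The subgraph of `G` induced by `U` has a layering `l`, with `S` in layer `0`, in which the first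
`m + 1` layers have at most `e * (2 * (4 * Δ) ^ m)` vertices in total, and a connected set within
any `m + 1` consecutive layers has at most `w * (2 * (4 * Δ) ^ m)` vertices. Only the values of `l`
on `U` matter. -/
def HasLayering (G : SimpleGraph V) (Δ w : ℕ) (U S : Finset V) (e : ℕ) : Prop :=
  ∃ l : V → ℕ, (∀ v ∈ S, l v = 0) ∧ (∀ u ∈ U, ∀ v ∈ U, G.Adj u v → l v ≤ l u + 1) ∧
    (∀ m, #(U.filter fun v => l v ≤ m) ≤ e * (2 * (4 * Δ) ^ m)) ∧
    ∀ a m, ∀ L ⊆ U, G.PreconnectedOn L → (∀ v ∈ L, a ≤ l v ∧ l v ≤ a + m) →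
      #L ≤ w * (2 * (4 * Δ) ^ m)

/-- A layering of `U \ R` that has the neighbours of `R` in layer `0` extends to `U`, with `R` as a
new layer in front. -/
theorem HasLayering.insert_layer [DecidableEq V] [DecidableRel G.Adj] {Δ w e e₁ : ℕ}
    {U R : Finset V}
    (h : G.HasLayering Δ w (U \ R) ((U \ R).filter fun v => ∃ u ∈ R, G.Adj u v) e₁)
    (hΔ : 0 < Δ) (hR : #R ≤ 2 * e) (he₁ : e₁ ≤ 2 * Δ * e) (hew : e ≤ w) :
    G.HasLayering Δ w U R e := by
  obtain ⟨l, hl0, hl1, hlm, hla⟩ := h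
  have hgrow : ∀ m, #(U.filter fun v => (if v ∈ R then 0 else l v + 1) ≤ m) ≤
      e * (2 * (4 * Δ) ^ m) := by
    intro m
    cases m with
    | zero =>
      have : (U.filter fun v => (if v ∈ R then 0 else l v + 1) ≤ 0) ⊆ R := by
        intro v hv
        by_contra hvR
        have := (mem_filter.1 hv).2
        rw [if_neg hvR] at this
        omega
      have := card_le_card this
      rw [pow_zero]
      omega
    | succ m =>
      have : (U.filter fun v => (if v ∈ R then 0 else l v + 1) ≤ m + 1) ⊆
          R ∪ (U \ R).filter fun v => l v ≤ m := by
        intro v hv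
        obtain ⟨hvU, hv⟩ := mem_filter.1 hv
        by_cases hvR : v ∈ R
        · exact mem_union_left _ hvR
        · rw [if_neg hvR] at hv
          exact mem_union_right _ (mem_filter.2 ⟨mem_sdiff.2 ⟨hvU, hvR⟩, by omega⟩)
      have h1 := (card_le_card this).trans (card_union_le _ _)
      have h2 := hlm m
      have h3 : 0 < (4 * Δ) ^ m := by positivity
      rw [pow_succ]
      generalize (4 * Δ) ^ m = p at *
      have h5 : e₁ * (2 * p) ≤ 2 * Δ * e * (2 * p) := Nat.mul_le_mul_right _ he₁
      have h6 : e ≤ Δ * e * p := by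
        calc e = 1 * e * 1 := by ring
          _ ≤ Δ * e * p := by gcongr <;> omega
      nlinarith
  refine ⟨fun v => if v ∈ R then 0 else l v + 1, fun v hv => if_pos hv, ?_, hgrow, ?_⟩
  · intro u hu v hv huv
    by_cases hvR : v ∈ R
    · simp [hvR]
    · by_cases huR : u ∈ R
      · simp [hvR, huR, hl0 v (mem_filter.2 ⟨mem_sdiff.2 ⟨hv, hvR⟩, u, huR, huv⟩)]
      · simpa [hvR, huR] using hl1 u (mem_sdiff.2 ⟨hu, huR⟩) v (mem_sdiff.2 ⟨hv, hvR⟩) huv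
  · intro a m L hL hLc hLa
    cases a with
    | zero =>
      calc #L ≤ _ := card_le_card fun v hv => mem_filter.2 ⟨hL hv, by simpa using (hLa v hv).2⟩
        _ ≤ e * (2 * (4 * Δ) ^ m) := hgrow m
        _ ≤ w * (2 * (4 * Δ) ^ m) := Nat.mul_le_mul_right _ hew
    | succ a =>
      beta_reduce at hLa
      have hLR : ∀ v ∈ L, v ∉ R := by
        intro v hv hvR
        have := (hLa v hv).1
        rw [if_pos hvR] at this
        omega
      refine hla a m L (fun v hv => mem_sdiff.2 ⟨hL hv, hLR v hv⟩) hLc fun v hv => ?_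
      have := hLa v hv
      rw [if_neg (hLR v hv)] at this
      omega

/-- Layerings of the two sides of a separation that have the separator in layer `0` can be put
together. -/
theorem HasLayering.union [DecidableEq V] {Δ w e e₁ e₂ : ℕ} {U A B S S₁ S₂ : Finset V}
    (hAB : G.IsSeparation U A B) (h₁ : G.HasLayering Δ w A S₁ e₁)
    (h₂ : G.HasLayering Δ w B S₂ e₂) (hX₁ : A ∩ B ⊆ S₁) (hX₂ : A ∩ B ⊆ S₂) (hSU : S ⊆ U)
    (hS₁ : S ∩ A ⊆ S₁) (hS₂ : S ∩ B ⊆ S₂) (hee : e₁ + e₂ ≤ e) (hew : e ≤ w) :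
    G.HasLayering Δ w U S e := by
  obtain ⟨l₁, h0₁, h1₁, hm₁, ha₁⟩ := h₁
  obtain ⟨l₂, h0₂, h1₂, hm₂, ha₂⟩ := h₂
  have hl : ∃ l : V → ℕ, (∀ v ∈ A, l v = l₁ v) ∧ ∀ v ∈ B, l v = l₂ v := by
    refine ⟨fun v => if v ∈ A then l₁ v else l₂ v, fun v hv => if_pos hv, fun v hv => ?_⟩
    by_cases hvA : v ∈ A
    · have : v ∈ A ∩ B := mem_inter.2 ⟨hvA, hv⟩
      beta_reduce
      rw [if_pos hvA, h0₁ v (hX₁ this), h0₂ v (hX₂ this)]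
    · exact if_neg hvA
  obtain ⟨l, hlA, hlB⟩ := hl
  have hUAB : ∀ {v}, v ∈ U → v ∈ A ∨ v ∈ B := fun hv => mem_union.1 (hAB.union_eq.symm ▸ hv)
  have hgrow : ∀ m, #(U.filter fun v => l v ≤ m) ≤ e * (2 * (4 * Δ) ^ m) := by
    intro m
    have : (U.filter fun v => l v ≤ m) ⊆
        (A.filter fun v => l₁ v ≤ m) ∪ B.filter fun v => l₂ v ≤ m := by
      intro v hv
      obtain ⟨hvU, hv⟩ := mem_filter.1 hv
      rcases hUAB hvU with h | h
      · exact mem_union_left _ (mem_filter.2 ⟨h, hlA v h ▸ hv⟩)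
      · exact mem_union_right _ (mem_filter.2 ⟨h, hlB v h ▸ hv⟩)
    calc _ ≤ _ := (card_le_card this).trans (card_union_le _ _)
      _ ≤ _ := Nat.add_le_add (hm₁ m) (hm₂ m)
      _ = (e₁ + e₂) * (2 * (4 * Δ) ^ m) := by ring
      _ ≤ e * (2 * (4 * Δ) ^ m) := Nat.mul_le_mul_right _ hee
  refine ⟨l, ?_, ?_, hgrow, ?_⟩
  · intro v hv
    rcases hUAB (hSU hv) with h | h
    · rw [hlA v h, h0₁ v (hS₁ (mem_inter.2 ⟨hv, h⟩))]
    · rw [hlB v h, h0₂ v (hS₂ (mem_inter.2 ⟨hv, h⟩))]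
  · intro u hu v hv huv
    have hside : (u ∈ A ∧ v ∈ A) ∨ (u ∈ B ∧ v ∈ B) := by
      rcases hUAB hu with h | h <;> rcases hUAB hv with h' | h'
      · exact Or.inl ⟨h, h'⟩
      · by_cases huB : u ∈ B
        · exact Or.inr ⟨huB, h'⟩
        · by_cases hvA : v ∈ A
          · exact Or.inl ⟨h, hvA⟩
          · exact absurd huv (hAB.not_adj u (mem_sdiff.2 ⟨h, huB⟩) v (mem_sdiff.2 ⟨h', hvA⟩))
      · by_cases huA : u ∈ A
        · exact Or.inl ⟨huA, h'⟩
        · by_cases hvB : v ∈ B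
          · exact Or.inr ⟨h, hvB⟩
          · exact absurd huv.symm
              (hAB.not_adj v (mem_sdiff.2 ⟨h', hvB⟩) u (mem_sdiff.2 ⟨h, huA⟩))
      · exact Or.inr ⟨h, h'⟩
    rcases hside with ⟨h, h'⟩ | ⟨h, h'⟩
    · rw [hlA u h, hlA v h']
      exact h1₁ u h v h' huv
    · rw [hlB u h, hlB v h']
      exact h1₂ u h v h' huv
  · intro a m L hL hLc hLa
    rcases Nat.eq_zero_or_pos a with rfl | ha
    · calc #L ≤ _ := card_le_card fun v hv => mem_filter.2 ⟨hL hv, by simpa using (hLa v hv).2⟩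
        _ ≤ e * (2 * (4 * Δ) ^ m) := hgrow m
        _ ≤ w * (2 * (4 * Δ) ^ m) := Nat.mul_le_mul_right _ hew
    · -- a set that avoids layer `0` avoids the separator
      rcases hAB.subset_or_subset hLc hL (fun v hv hvA hvB => by
        have h1 := (hLa v hv).1
        rw [hlA v hvA, h0₁ v (hX₁ (mem_inter.2 ⟨hvA, hvB⟩))] at h1
        omega) with h | h
      · have h := h.trans sdiff_subset
        exact ha₁ a m L h hLc fun v hv => hlA v (h hv) ▸ hLa v hv
      · have h := h.trans sdiff_subset
        exact ha₂ a m L h hLc fun v hv => hlB v (h hv) ▸ hLa v hv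

theorem HasLayering.mono {Δ w e e' : ℕ} {U S S' : Finset V} (h : G.HasLayering Δ w U S e)
    (hS : S' ⊆ S) (he : e ≤ e') : G.HasLayering Δ w U S' e' := by
  obtain ⟨l, h0, h1, hm, ha⟩ := h
  exact ⟨l, fun v hv => h0 v (hS hv), h1, fun m => (hm m).trans (Nat.mul_le_mul_right _ he), ha⟩

/-- A graph of maximum degree at most `Δ` with a tree-decomposition into bags of size at most `K`
has a layering in which a connected set within `m + 1` consecutive layers has boundedly many
vertices. The induction puts a given set `S` of at most `2 * K + e` vertices into layer `0` and
keeps the first `m + 1` layers below a bound that is linear in `e`.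

If `S` is small, it forms layer `0` and the induction hypothesis puts its neighbours into layer `1`.
If `S` is large, a separation `(A, B)` that is balanced with respect to `S` is used, with the
separator added to layer `0` on both sides. Since `e` is counted from `2 * K`, its values for the
two sides add up to at most `e` although the separator is counted twice. -/
theorem TreeDecomposition.hasLayering [Fintype V] [DecidableEq V] [DecidableRel G.Adj]
    {ι : Type*} [Fintype ι] {T : SimpleGraph ι} (D : G.TreeDecomposition T) {K Δ : ℕ}
    (hK : ∀ x, #(D.bag x) ≤ K) (hK0 : 0 < K) (hdeg : G.maxDegree ≤ Δ) (hΔ : 0 < Δ)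
    (U S : Finset V) (hSU : S ⊆ U) (e : ℕ) (hS : #S ≤ 2 * K + e) (he : 2 * K ≤ e)
    (he' : 2 * K + e ≤ 12 * K * Δ) : G.HasLayering Δ (12 * K * Δ) U S e := by
  induction U using Finset.strongInduction generalizing S e with
  | H U ih =>
  rcases U.eq_empty_or_nonempty with rfl | ⟨v₀, hv₀⟩
  · refine ⟨fun _ => 0, by simp, by simp, by simp, fun a m L hL _ _ => ?_⟩
    simp [subset_empty.1 hL]
  by_cases hS12 : #S ≤ 12 * K
  · -- `R` is `S`, made nonempty so that `U \ R` is smaller than `U`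
    obtain ⟨R, hSR, hRU, hRne, hR⟩ : ∃ R, S ⊆ R ∧ R ⊆ U ∧ R.Nonempty ∧ #R ≤ max #S (4 * K) := by
      rcases S.eq_empty_or_nonempty with rfl | hne
      · refine ⟨{v₀}, empty_subset _, by simpa using hv₀, singleton_nonempty _, ?_⟩
        simp only [card_singleton]
        omega
      · exact ⟨S, subset_rfl, hSU, hne, le_max_left _ _⟩
    obtain ⟨e₀, he₀⟩ : ∃ e₀, max #S (4 * K) = 2 * K + e₀ := ⟨max #S (4 * K) - 2 * K, by omega⟩
    have he₀e : e₀ ≤ e := by omega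
    have he₀K : 2 * K ≤ e₀ := by omega
    -- `R` has at most `Δ * #R ≤ 2 * K + e₁` neighbours
    obtain ⟨e₁, he₁⟩ : ∃ e₁, Δ * (2 * K + e₀) = 2 * K + e₁ :=
      ⟨Δ * (2 * K + e₀) - 2 * K, by
        have : 2 * K + e₀ ≤ Δ * (2 * K + e₀) := Nat.le_mul_of_pos_left _ hΔ
        omega⟩
    have hN : #((U \ R).filter fun v => ∃ u ∈ R, G.Adj u v) ≤ 2 * K + e₁ := by
      have h1 : ((U \ R).filter fun v => ∃ u ∈ R, G.Adj u v) ⊆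
          R.biUnion fun u => G.neighborFinset u := by
        intro v hv
        obtain ⟨-, u, hu, huv⟩ := mem_filter.1 hv
        exact mem_biUnion.2 ⟨u, hu, (mem_neighborFinset _ _ _).2 huv⟩
      have h2 : #(R.biUnion fun u => G.neighborFinset u) ≤ #R * Δ :=
        card_biUnion_le_card_mul _ _ _ fun u _ => by
          rw [card_neighborFinset_eq_degree]
          exact (G.degree_le_maxDegree u).trans hdeg
      calc _ ≤ #R * Δ := (card_le_card h1).trans h2
        _ ≤ (2 * K + e₀) * Δ := Nat.mul_le_mul_right _ (hR.trans he₀.le)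
        _ = 2 * K + e₁ := by rw [← he₁, mul_comm]
    refine (HasLayering.insert_layer (e := e₀) (ih (U \ R) (sdiff_ssubset hRU hRne) _
      (filter_subset _ _) e₁ hN ?_ ?_) hΔ (by omega) (by nlinarith) (by omega)).mono hSR he₀e
    · have : 2 * K + e₀ ≤ Δ * (2 * K + e₀) := Nat.le_mul_of_pos_left _ hΔ
      omega
    · rw [← he₁, mul_comm]
      exact Nat.mul_le_mul_right _ (by omega)
  · -- `A` contains between `4 * K` and `8 * K` of the more than `12 * K` vertices of `S`, so that
    -- either side has at least `4 * K` of them, as the induction hypothesis asks for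
    obtain ⟨A, B, hAB, hX, hA, hA'⟩ := D.exists_separation hK (q := ((4 * K : ℕ) : ℝ))
      (mod_cast (by omega)) hSU (mod_cast (by omega))
    have hA : 4 * K < #(S ∩ A) := mod_cast hA
    have hA' : #(S ∩ A) ≤ 2 * (4 * K) := mod_cast hA'
    have hAU : A ⊆ U := hAB.union_eq ▸ subset_union_left
    have hBU : B ⊆ U := hAB.union_eq ▸ subset_union_right
    have hcov : #S ≤ #(S ∩ (A \ B)) + #(S ∩ B) := by
      refine (card_le_card fun v hv => ?_).trans (card_union_le _ _)
      have := hSU hv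
      rw [← hAB.union_eq] at this
      simp only [mem_union, mem_inter, mem_sdiff] at *
      tauto
    have hdisj : #(S ∩ (A \ B)) + #(S ∩ (B \ A)) ≤ #S := by
      rw [← card_union_of_disjoint (Finset.disjoint_left.2 ?_)]
      · exact card_le_card (union_subset inter_subset_left inter_subset_left)
      · simp only [mem_inter, mem_sdiff]
        tauto
    have hAB1 : #(S ∩ (A \ B)) ≤ #(S ∩ A) := card_le_card (by gcongr; exact sdiff_subset)
    have hSA : #(S ∩ A ∪ A ∩ B) ≤ #(S ∩ (A \ B)) + K := by
      refine (card_le_card fun v hv => ?_).trans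
        ((card_union_le (S ∩ (A \ B)) (A ∩ B)).trans (Nat.add_le_add_left hX _))
      simp only [mem_union, mem_inter, mem_sdiff] at *
      tauto
    have hSB : #(S ∩ B ∪ A ∩ B) ≤ #(S ∩ (B \ A)) + K := by
      refine (card_le_card fun v hv => ?_).trans
        ((card_union_le (S ∩ (B \ A)) (A ∩ B)).trans (Nat.add_le_add_left hX _))
      simp only [mem_union, mem_inter, mem_sdiff] at *
      tauto
    have hSA' : #(S ∩ A) ≤ #(S ∩ A ∪ A ∩ B) := card_le_card subset_union_left
    have hSB' : #(S ∩ B) ≤ #(S ∩ B ∪ A ∩ B) := card_le_card subset_union_left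
    have hAne : A ⊂ U := by
      refine ssubset_of_subset_of_ne hAU fun h => ?_
      rw [h, inter_eq_left.2 hSU] at hA'
      omega
    have hBne : B ⊂ U := by
      refine ssubset_of_subset_of_ne hBU fun h => ?_
      have : S ∩ A ⊆ A ∩ B := fun v hv =>
        mem_inter.2 ⟨(mem_inter.1 hv).2, h ▸ hSU (mem_inter.1 hv).1⟩
      have := card_le_card this
      omega
    exact HasLayering.union hAB
      (ih A hAne (S ∩ A ∪ A ∩ B) (union_subset inter_subset_right inter_subset_left)
        (#(S ∩ A ∪ A ∩ B) - 2 * K) (by omega) (by omega) (by omega))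
      (ih B hBne (S ∩ B ∪ A ∩ B) (union_subset inter_subset_right inter_subset_right)
        (#(S ∩ B ∪ A ∩ B) - 2 * K) (by omega) (by omega) (by omega))
      subset_union_right subset_union_right hSU subset_union_left subset_union_left
      (by omega) (by omega)

end

/-! ### Cyclic colours and the comparison of exponents -/

/-- The colour of class `i` in layer `x` of the second factor is `i + (x + i) / m` modulo `m + 1`.
This says that two classes never share a colour in the same layer or in consecutive layers, and
that a class keeps its colour from one layer to the next only if the quotient stays the same. -/
theorem eq_and_div_eq_of_modEq {m i j x y : ℕ} (hi : i < m) (hj : j < m) (hxy : x ≤ y + 1)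
    (hyx : y ≤ x + 1) (h : i + (x + i) / m ≡ j + (y + j) / m [MOD m + 1]) :
    i = j ∧ (x + i) / m = (y + j) / m := by
  wlog hij : i + (x + i) / m ≤ j + (y + j) / m generalizing i j x y
  · have := this hj hi hyx hxy h.symm (by omega)
    exact ⟨this.1.symm, this.2.symm⟩
  have hm : 0 < m := by omega
  have hdvd := (Nat.modEq_iff_dvd' hij).1 h
  have hlt : j + (y + j) / m - (i + (x + i) / m) < m + 1 := by
    rcases le_total i j with hle | hle
    · rcases hle.eq_or_lt with rfl | hlt
      · have : (y + i) / m ≤ (x + i) / m + 1 := by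
          rw [← Nat.add_div_right _ hm]
          exact Nat.div_le_div_right (by omega)
        omega
      · have : (y + j) / m ≤ (x + i) / m + 1 := by
          rw [← Nat.add_div_right _ hm]
          exact Nat.div_le_div_right (by omega)
        omega
    · have : (y + j) / m ≤ (x + i) / m + 1 := by
        rw [← Nat.add_div_right _ hm]
        exact Nat.div_le_div_right (by omega)
      omega
  have heq := Nat.eq_zero_of_dvd_of_lt hdvd hlt
  rcases lt_trichotomy i j with hlt' | rfl | hlt'
  · have : (x + i) / m ≤ (y + j) / m := Nat.div_le_div_right (by omega)
    omega
  · omega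
  · have : (y + j) / m ≤ (x + i) / m := Nat.div_le_div_right (by omega)
    omega

/-- If the first factor is much larger than the second, colouring the first factor suffices. -/
theorem rpow_inv_mul_le_of_pow_le {x y : ℝ} (hx : 1 ≤ x) (hy : 1 ≤ y) (m : ℕ)
    (h : y ^ ((m + 1) * m) ≤ x) :
    x ^ (((m + 1 : ℕ) : ℝ)⁻¹) * y ≤
      (x * y) ^ (((m + 1 : ℕ) : ℝ) / (((m + 1 : ℕ) : ℝ) ^ 2 - ((m + 1 : ℕ) : ℝ) + 1)) := by
  have hx0 : 0 < x := by linarith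
  have hy0 : 0 < y := by linarith
  have hp : (0 : ℝ) < ((m + 1 : ℕ) : ℝ) ^ 2 - ((m + 1 : ℕ) : ℝ) + 1 := by
    push_cast
    nlinarith [(m.cast_nonneg : (0 : ℝ) ≤ m)]
  generalize hpe : ((m + 1 : ℕ) : ℝ) ^ 2 - ((m + 1 : ℕ) : ℝ) + 1 = p at *
  have hc : (0 : ℝ) < ((m + 1 : ℕ) : ℝ) := by positivity
  have h1 : y ^ (1 - ((m + 1 : ℕ) : ℝ) / p) ≤
      x ^ (((m + 1 : ℕ) : ℝ) / p - ((m + 1 : ℕ) : ℝ)⁻¹) := by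
    have h2 : ((m + 1 : ℕ) : ℝ) / p - ((m + 1 : ℕ) : ℝ)⁻¹ = m / (((m + 1 : ℕ) : ℝ) * p) := by
      field_simp
      rw [← hpe]
      push_cast
      ring
    have h3 : 1 - ((m + 1 : ℕ) : ℝ) / p =
        (((m + 1) * m : ℕ) : ℝ) * (m / (((m + 1 : ℕ) : ℝ) * p)) := by
      field_simp
      rw [← hpe]
      push_cast
      ring
    rw [h2, h3, Real.rpow_mul hy0.le, Real.rpow_natCast]
    gcongr
  calc x ^ (((m + 1 : ℕ) : ℝ)⁻¹) * y
      = x ^ (((m + 1 : ℕ) : ℝ)⁻¹) * (y ^ (1 - ((m + 1 : ℕ) : ℝ) / p) *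
          y ^ (((m + 1 : ℕ) : ℝ) / p)) := by
        rw [← Real.rpow_add hy0, sub_add_cancel, Real.rpow_one]
    _ ≤ x ^ (((m + 1 : ℕ) : ℝ)⁻¹) * (x ^ (((m + 1 : ℕ) : ℝ) / p - ((m + 1 : ℕ) : ℝ)⁻¹) *
          y ^ (((m + 1 : ℕ) : ℝ) / p)) := by gcongr
    _ = (x * y) ^ (((m + 1 : ℕ) : ℝ) / p) := by
        rw [← mul_assoc, ← Real.rpow_add hx0, add_sub_cancel, Real.mul_rpow hx0.le hy0.le]

/-- If the first factor is not much larger than the second, one colour fewer may be spent on it. -/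
theorem rpow_inv_le_of_le_pow {x y : ℝ} (hx : 1 ≤ x) (hy : 1 ≤ y) (m : ℕ) (hm : 0 < m)
    (h : x ≤ y ^ ((m + 1) * m)) :
    x ^ ((m : ℝ)⁻¹) ≤
      (x * y) ^ (((m + 1 : ℕ) : ℝ) / (((m + 1 : ℕ) : ℝ) ^ 2 - ((m + 1 : ℕ) : ℝ) + 1)) := by
  have hx0 : 0 < x := by linarith
  have hy0 : 0 < y := by linarith
  have hm' : (0 : ℝ) < m := mod_cast hm
  have hp : (0 : ℝ) < ((m + 1 : ℕ) : ℝ) ^ 2 - ((m + 1 : ℕ) : ℝ) + 1 := by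
    push_cast
    nlinarith
  generalize hpe : ((m + 1 : ℕ) : ℝ) ^ 2 - ((m + 1 : ℕ) : ℝ) + 1 = p at *
  have h1 : (m : ℝ)⁻¹ = ((m + 1 : ℕ) : ℝ) / p + 1 / (m * p) := by
    field_simp
    rw [← hpe]
    push_cast
    ring
  have h2 : ((m + 1 : ℕ) : ℝ) / p = (((m + 1) * m : ℕ) : ℝ) * (1 / (m * p)) := by
    field_simp
    push_cast
    ring
  rw [h1, Real.rpow_add hx0, Real.mul_rpow hx0.le hy0.le]
  gcongr
  conv_rhs => rw [h2, Real.rpow_mul hy0.le, Real.rpow_natCast]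
  gcongr

/-! ### Clustering -/

theorem clustering_le {V α : Type*} [Finite V] {G : SimpleGraph V} {f : V → α} {k : ℝ} (hk : 0 ≤ k)
    (h : ∀ i, ∀ L : Finset V, G.PreconnectedOn L → (∀ v ∈ L, f v = i) → (#L : ℝ) ≤ k) :
    (G.clustering f : ℝ) ≤ k := by
  classical
  rw [← Nat.le_floor_iff hk]
  refine csSup_le' ?_
  rintro _ ⟨S, ⟨i, C, rfl⟩, rfl⟩
  rw [Nat.le_floor_iff hk, Set.ncard_eq_toFinset_card _ (Set.toFinite _)]
  have hmem : ∀ v, v ∈ (Set.toFinite (Subtype.val '' C.supp)).toFinset ↔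
      ∃ h : v ∈ {v | f v = i}, (G.induce {v | f v = i}).connectedComponentMk ⟨v, h⟩ = C := by
    intro v
    rw [Set.Finite.mem_toFinset]
    constructor
    · rintro ⟨w, hw, rfl⟩
      exact ⟨w.2, hw⟩
    · rintro ⟨hv, hC⟩
      exact ⟨⟨v, hv⟩, hC, rfl⟩
  exact h i _ (preconnectedOn_of_connectedComponent C hmem) fun v hv => ((hmem v).1 hv).1

/-! ### Connected sets in strong products -/

variable {V₁ V₂ : Type*} {H₁ : SimpleGraph V₁} {H₂ : SimpleGraph V₂}

theorem PreconnectedOn.image_fst [DecidableEq V₁] {L : Finset (V₁ × V₂)}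
    (hL : (H₁.strongProduct H₂).PreconnectedOn L) : H₁.PreconnectedOn (L.image Prod.fst) := by
  refine preconnectedOn_of_induction fun P hP u hu v hv hPu => ?_
  obtain ⟨p, hp, rfl⟩ := mem_image.1 hu
  obtain ⟨q, hq, rfl⟩ := mem_image.1 hv
  refine hL.induction (fun p => P p.1) (fun a ha b hb hab hPa => ?_) hp hq hPu
  rcases hab with ⟨h, -⟩ | ⟨-, h⟩ | ⟨h, -⟩
  · exact h ▸ hPa
  all_goals exact hP _ (mem_image_of_mem _ ha) _ (mem_image_of_mem _ hb) h hPa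

theorem PreconnectedOn.image_snd [DecidableEq V₂] {L : Finset (V₁ × V₂)}
    (hL : (H₁.strongProduct H₂).PreconnectedOn L) : H₂.PreconnectedOn (L.image Prod.snd) := by
  refine preconnectedOn_of_induction fun P hP u hu v hv hPu => ?_
  obtain ⟨p, hp, rfl⟩ := mem_image.1 hu
  obtain ⟨q, hq, rfl⟩ := mem_image.1 hv
  refine hL.induction (fun p => P p.2) (fun a ha b hb hab hPa => ?_) hp hq hPu
  rcases hab with ⟨-, h⟩ | ⟨h, -⟩ | ⟨-, h⟩
  · exact hP _ (mem_image_of_mem _ ha) _ (mem_image_of_mem _ hb) h hPa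
  · exact h ▸ hPa
  · exact hP _ (mem_image_of_mem _ ha) _ (mem_image_of_mem _ hb) h hPa

theorem card_le_card_image_fst_mul_card_image_snd [DecidableEq V₁] [DecidableEq V₂]
    (L : Finset (V₁ × V₂)) : #L ≤ #(L.image Prod.fst) * #(L.image Prod.snd) := by
  rw [← card_product]
  exact card_le_card subset_product

/-! ### Colourings of strong products -/

theorem exists_treeDecomposition_of_treewidth_le {V : Type*} [Finite V] (G : SimpleGraph V) {t : ℕ}
    (h : G.treewidth ≤ t) :
    ∃ (n : ℕ) (T : SimpleGraph (Fin n)) (D : G.TreeDecomposition T), ∀ x, #(D.bag x) ≤ t + 1 := by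
  obtain ⟨n, T, D, hD⟩ := G.treewidth_mem
  refine ⟨n, T, D, fun x => ?_⟩
  have h1 : #(D.bag x) ≤ univ.sup fun x => #(D.bag x) :=
    le_sup (f := fun x => #(D.bag x)) (mem_univ x)
  rw [← hD, TreeDecomposition.width] at h
  omega

/-- Colouring a strong product by a clustered colouring of its first factor. -/
theorem exists_colouring_of_fst [Fintype V₁] [Fintype V₂] {ι : Type*} [Fintype ι]
    {T : SimpleGraph ι} (D : H₁.TreeDecomposition T) {K : ℕ} (hK : ∀ x, #(D.bag x) ≤ K)
    (hK0 : 0 < K) (hV : 0 < Fintype.card V₁) (m : ℕ) :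
    ∃ f : V₁ × V₂ → Fin (m + 1), ((H₁.strongProduct H₂).clustering f : ℝ) ≤
      2 * K * (Fintype.card V₁ : ℝ) ^ (((m + 1 : ℕ) : ℝ)⁻¹) * Fintype.card V₂ := by
  classical
  have hV' : (0 : ℝ) < Fintype.card V₁ := mod_cast hV
  obtain ⟨f, hf⟩ := D.exists_clustered_colouring hK hK0
    (r := (Fintype.card V₁ : ℝ) ^ (((m + 1 : ℕ) : ℝ)⁻¹)) (by positivity) m univ (fun L _ _ => by
      rw [Real.rpow_inv_natCast_pow hV'.le (by omega)]
      exact mod_cast card_le_univ L)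
  refine ⟨fun p => f p.1, clustering_le (by positivity) fun i L hL hi => ?_⟩
  have h1 := hf i (L.image Prod.fst) (subset_univ _) hL.image_fst (by
    intro v hv
    obtain ⟨p, hp, rfl⟩ := mem_image.1 hv
    exact hi p hp)
  have h2 : (#(L.image Prod.snd) : ℝ) ≤ Fintype.card V₂ := mod_cast card_le_univ _
  calc (#L : ℝ) ≤ #(L.image Prod.fst) * #(L.image Prod.snd) :=
        mod_cast card_le_card_image_fst_mul_card_image_snd L
    _ ≤ _ := by gcongr

/-- Combining a clustered colouring of the first factor in `m + 1` classes with a layering of the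
second factor to a colouring of the strong product in `m + 2` colours. In each layer the classes
have distinct colours and one colour is spare; from one layer to the next a single class moves to
the spare colour, and each class moves once in `m + 1` layers. -/
theorem exists_colouring_of_layering [Fintype V₁] [Fintype V₂] [DecidableRel H₂.Adj]
    {ι₁ ι₂ : Type*} [Fintype ι₁] [Fintype ι₂] {T₁ : SimpleGraph ι₁} {T₂ : SimpleGraph ι₂}
    (D₁ : H₁.TreeDecomposition T₁) (D₂ : H₂.TreeDecomposition T₂) {K Δ : ℕ}
    (hK₁ : ∀ x, #(D₁.bag x) ≤ K) (hK₂ : ∀ x, #(D₂.bag x) ≤ K) (hK0 : 0 < K)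
    (hdeg : H₂.maxDegree ≤ Δ) (hΔ : 0 < Δ) (hV : 0 < Fintype.card V₁) (m : ℕ) :
    ∃ f : V₁ × V₂ → Fin (m + 2), ((H₁.strongProduct H₂).clustering f : ℝ) ≤
      2 * K * (Fintype.card V₁ : ℝ) ^ (((m + 1 : ℕ) : ℝ)⁻¹) *
        (12 * K * Δ * (2 * (4 * Δ) ^ m) : ℕ) := by
  classical
  have hV' : (0 : ℝ) < Fintype.card V₁ := mod_cast hV
  obtain ⟨s, hs⟩ := D₁.exists_clustered_colouring hK₁ hK0
    (r := (Fintype.card V₁ : ℝ) ^ (((m + 1 : ℕ) : ℝ)⁻¹)) (by positivity) m univ (fun L _ _ => by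
      rw [Real.rpow_inv_natCast_pow hV'.le (by omega)]
      exact mod_cast card_le_univ L)
  obtain ⟨l, -, hl, -, hlL⟩ := D₂.hasLayering hK₂ hK0 hdeg hΔ univ ∅ (empty_subset _) (2 * K)
    (by simp) le_rfl (by nlinarith)
  refine ⟨fun p => ⟨(s p.1 + (l p.2 + s p.1) / (m + 1)) % (m + 1 + 1), Nat.mod_lt _ (by omega)⟩,
    clustering_le (by positivity) fun i L hL hi => ?_⟩
  rcases L.eq_empty_or_nonempty with rfl | ⟨p₀, hp₀⟩
  · simp only [card_empty, Nat.cast_zero]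
    positivity
  have hstep : ∀ p ∈ L, ∀ q ∈ L, (H₁.strongProduct H₂).Adj p q →
      ((s p.1 : ℕ), (l p.2 + s p.1) / (m + 1)) = ((s q.1 : ℕ), (l q.2 + s q.1) / (m + 1)) := by
    intro p hp q hq hpq
    have hll : l p.2 ≤ l q.2 + 1 ∧ l q.2 ≤ l p.2 + 1 := by
      rcases hpq with ⟨-, h⟩ | ⟨h, -⟩ | ⟨-, h⟩
      · exact ⟨hl _ (mem_univ _) _ (mem_univ _) h.symm, hl _ (mem_univ _) _ (mem_univ _) h⟩
      · simp [h]
      · exact ⟨hl _ (mem_univ _) _ (mem_univ _) h.symm, hl _ (mem_univ _) _ (mem_univ _) h⟩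
    have hcol := Fin.mk.inj ((hi p hp).trans (hi q hq).symm)
    have := eq_and_div_eq_of_modEq (s p.1).2 (s q.1).2 hll.1 hll.2 hcol
    exact Prod.ext this.1 this.2
  have hconst := fun p (hp : p ∈ L) => Prod.mk.inj (hL.eq_of_adj _ hstep hp hp₀)
  have h1 := hs (s p₀.1) (L.image Prod.fst) (subset_univ _) hL.image_fst (by
    intro v hv
    obtain ⟨p, hp, rfl⟩ := mem_image.1 hv
    exact Fin.ext (hconst p hp).1)
  have h2 := hlL ((l p₀.2 + s p₀.1) / (m + 1) * (m + 1) - s p₀.1) m (L.image Prod.snd)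
    (subset_univ _) hL.image_snd (by
      intro v hv
      obtain ⟨p, hp, rfl⟩ := mem_image.1 hv
      obtain ⟨hp1, hp2⟩ := hconst p hp
      rw [hp1] at hp2
      have h3 := Nat.div_mul_le_self (l p.2 + s p₀.1) (m + 1)
      have h4 := Nat.lt_div_mul_add (a := l p.2 + s p₀.1) (b := m + 1) (by omega)
      rw [hp2] at h3 h4
      omega)
  calc (#L : ℝ) ≤ #(L.image Prod.fst) * #(L.image Prod.snd) :=
        mod_cast card_le_card_image_fst_mul_card_image_snd L
    _ ≤ _ := by gcongr

end SimpleGraph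

theorem mainTheorem4 {V₁ V₂ : Type*} [Fintype V₁] [Fintype V₂]
    (t c Δ : ℕ) (ht : 0 < t) (hc : 0 < c) (hΔ : 0 < Δ)
    (H₁ : SimpleGraph V₁) (H₂ : SimpleGraph V₂) [DecidableRel H₂.Adj]
    (htw₁ : H₁.treewidth ≤ (t : ℤ)) (htw₂ : H₂.treewidth ≤ (t : ℤ))
    (hdeg : H₂.maxDegree ≤ Δ) :
    (H₁.strongProduct H₂).ColourableWithClusteringAtMost c
      (6 ^ (c + 1) * ((t : ℝ) + 1) ^ 2 * (Δ : ℝ) ^ c *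
        (Fintype.card (V₁ × V₂) : ℝ) ^ ((c : ℝ) / ((c : ℝ) ^ 2 - (c : ℝ) + 1))) := by
  rcases isEmpty_or_nonempty (V₁ × V₂) with hV | ⟨⟨v₁, v₂⟩⟩
  · refine ⟨fun _ => ⟨0, hc⟩, SimpleGraph.clustering_le (by positivity) fun i L _ _ => ?_⟩
    rw [Finset.eq_empty_of_isEmpty L, Finset.card_empty, Nat.cast_zero]
    positivity
  have hV₁ : 0 < Fintype.card V₁ := Fintype.card_pos_iff.2 ⟨v₁⟩
  have hV₂ : 0 < Fintype.card V₂ := Fintype.card_pos_iff.2 ⟨v₂⟩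
  have hn₁ : (1 : ℝ) ≤ Fintype.card V₁ := mod_cast hV₁
  have hn₂ : (1 : ℝ) ≤ Fintype.card V₂ := mod_cast hV₂
  have hΔ1 : (1 : ℝ) ≤ Δ := mod_cast hΔ
  have ht1 : (1 : ℝ) ≤ (t : ℝ) + 1 := by linarith [(t.cast_nonneg : (0 : ℝ) ≤ t)]
  obtain ⟨n₁, T₁, D₁, hD₁⟩ := H₁.exists_treeDecomposition_of_treewidth_le htw₁
  obtain ⟨n₂, T₂, D₂, hD₂⟩ := H₂.exists_treeDecomposition_of_treewidth_le htw₂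
  rw [Fintype.card_prod, Nat.cast_mul]
  obtain ⟨m, rfl⟩ : ∃ m, c = m + 1 := ⟨c - 1, by omega⟩
  by_cases hle : (Fintype.card V₂ : ℝ) ^ ((m + 1) * m) ≤ Fintype.card V₁
  · obtain ⟨f, hf⟩ := SimpleGraph.exists_colouring_of_fst (H₂ := H₂) D₁ hD₁ t.succ_pos hV₁ m
    refine ⟨f, hf.trans ?_⟩
    rw [mul_assoc]
    refine mul_le_mul ?_ (SimpleGraph.rpow_inv_mul_le_of_pow_le hn₁ hn₂ m hle)
      (by positivity) (by positivity)
    push_cast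
    calc 2 * ((t : ℝ) + 1) = 2 * ((t : ℝ) + 1) ^ 1 * 1 := by ring
      _ ≤ 6 ^ (m + 1 + 1) * ((t : ℝ) + 1) ^ 2 * (Δ : ℝ) ^ (m + 1) := by
        gcongr
        · calc (2 : ℝ) ≤ 6 ^ 1 := by norm_num
            _ ≤ 6 ^ (m + 1 + 1) := by gcongr <;> norm_num
        · norm_num
        · exact one_le_pow₀ hΔ1
  · have hm : m ≠ 0 := by
      rintro rfl
      exact hle (by simpa using hn₁)
    obtain ⟨m, rfl⟩ := Nat.exists_eq_succ_of_ne_zero hm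
    obtain ⟨f, hf⟩ :=
      SimpleGraph.exists_colouring_of_layering D₁ D₂ hD₁ hD₂ t.succ_pos hdeg hΔ hV₁ m
    refine ⟨f, hf.trans ?_⟩
    rw [mul_right_comm]
    refine mul_le_mul ?_
      (SimpleGraph.rpow_inv_le_of_le_pow hn₁ hn₂ (m + 1) m.succ_pos (not_le.1 hle).le)
      (by positivity) (by positivity)
    push_cast
    calc 2 * ((t : ℝ) + 1) * (12 * ((t : ℝ) + 1) * Δ * (2 * (4 * Δ) ^ m))
        = 48 * 4 ^ m * ((t : ℝ) + 1) ^ 2 * (Δ : ℝ) ^ (m + 1) := by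
          rw [mul_pow]
          ring
      _ ≤ 6 ^ 3 * 6 ^ m * ((t : ℝ) + 1) ^ 2 * (Δ : ℝ) ^ (m + 1 + 1) := by
        gcongr <;> norm_num
      _ = 6 ^ (m + 1 + 1 + 1) * ((t : ℝ) + 1) ^ 2 * (Δ : ℝ) ^ (m + 1 + 1) := by ring
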